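/- Let $(M,\nabla)$ be an affine manifold, i.e. a smooth manifold $M$ with a smooth connection $\nabla$ on $TM$ that is torsion-free and has vanishing curvature, and let $h$ be a smooth symmetric bivector field on $M$ (a symmetric bilinear form on each $T_x^*M$, depending smoothly on $x$). Let $h_\#:T^*M\to TM$ be defined by $\beta(h_\#(\alpha))=h(\alpha,\beta)$, extend $\nabla$ to one-forms and to $h$ in the usual way, and for $\alpha,\beta\in\Omega^1(M)$ and a vector field $X$ put $$[\alpha,\beta]_h:=\nabla_{h_\#(\alpha)}\beta-\nabla_{h_\#(\beta)}\alpha,\qquad (\mathcal D_\alpha\beta)(X):=(\nabla_Xh)(\alpha,\beta)+(\nabla_{h_\#(\alpha)}\beta)(X).$$ Then the following assertions are equivalent: (i) $h$ satisfies the contravariant Codazzi equation $(\nabla_{h_\#(\alpha)}h)(\beta,\gamma)=(\nabla_{h_\#(\beta)}h)(\alpha,\gamma)$ for all $\alpha,\beta,\gamma\in\Omega^1(M)$. (ii) $(T^*M,h_\#,[\,,]_h)$ is a Lie algebroid, i.e. $h_\#$ is a smooth bundle map and $[\,,]_h$ is a Lie bracket on $\Omega^1(M)$ (real bilinear, skew-symmetric,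 satisfying the Jacobi identity) with $[\alpha,f\beta]_h=f[\alpha,\beta]_h+h_\#(\alpha)(f)\,\beta$ for all $f\in C^\infty(M)$. In this case $h_\#([\alpha,\beta]_h)=[h_\#(\alpha),h_\#(\beta)]$ for all $\alpha,\beta\in\Omega^1(M)$, the operator $\mathcal D$ is a connection for this Lie algebroid, i.e. a biadditive map $\Omega^1(M)\times\Omega^1(M)\to\Omega^1(M)$ with $\mathcal D_{f\alpha}\beta=f\mathcal D_\alpha\beta$ and $\mathcal D_\alpha(f\beta)=f\mathcal D_\alpha\beta+h_\#(\alpha)(f)\,\beta$, and for all $\alpha,\beta\in\Omega^1(M)$ $$h_\#(\mathcal D_\alpha\beta)=\nabla_{h_\#(\alpha)}h_\#(\beta)\quad\text{and}\quad R_{\mathcal D}(\alpha,\beta):=\mathcal D_{[\alpha,\beta]_h}-\mathcal D_\alpha\mathcal D_\beta+\mathcal D_\beta\mathcal D_\alpha=0.$$ -/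

import Mathlib

set_option maxSynthPendingDepth 3

open Bundle Module
open scoped Manifold ContDiff

noncomputable section

section LinearAlgebra

variable {V : Type*} [AddCommGroup V] [Module ℝ V] [TopologicalSpace V]
  [IsTopologicalAddGroup V] [ContinuousSMul ℝ V] [T2Space V] [FiniteDimensional ℝ V]

/-- For a finite-dimensional space `V` and a bilinear form `B` on `V*`, the contraction
`V* → V` sending `a` to the unique vector `v` such that `b v = B a b` for all `b` in `V*`
(see `sharpMap_spec`). -/
def sharpMap (B : (V →L[ℝ] ℝ) →L[ℝ] (V →L[ℝ] ℝ) →L[ℝ] ℝ) : (V →L[ℝ] ℝ) →L[ℝ] V :=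
  haveI : FiniteDimensional ℝ (V →L[ℝ] ℝ) :=
    (LinearMap.toContinuousLinearMap : (V →ₗ[ℝ] ℝ) ≃ₗ[ℝ] (V →L[ℝ] ℝ)).finiteDimensional
  LinearMap.toContinuousLinearMap
    { toFun := fun a => (evalEquiv ℝ V).symm
        ((B a).toLinearMap ∘ₗ (LinearMap.toContinuousLinearMap :
          (V →ₗ[ℝ] ℝ) ≃ₗ[ℝ] (V →L[ℝ] ℝ)).toLinearMap)
      map_add' := fun a b => by
        rw [← map_add]; congr 1; ext c; simp
      map_smul' := fun r a => by
        rw [RingHom.id_apply, ← map_smul]; congr 1; ext c; simp }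

theorem sharpMap_spec (B : (V →L[ℝ] ℝ) →L[ℝ] (V →L[ℝ] ℝ) →L[ℝ] ℝ) (a b : V →L[ℝ] ℝ) :
    b (sharpMap B a) = B a b := by
  have h := Module.apply_evalEquiv_symm_apply (R := ℝ) (M := V) b.toLinearMap
    ((B a).toLinearMap ∘ₗ (LinearMap.toContinuousLinearMap :
          (V →ₗ[ℝ] ℝ) ≃ₗ[ℝ] (V →L[ℝ] ℝ)).toLinearMap)
  exact h

/-- A bilinear form with its two arguments exchanged. -/
def flipForm (L : V →L[ℝ] V →L[ℝ] ℝ) : V →L[ℝ] V →L[ℝ] ℝ :=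
  LinearMap.toContinuousLinearMap
    { toFun := fun v => LinearMap.toContinuousLinearMap
        { toFun := fun w => L w v
          map_add' := fun a b => by simp
          map_smul' := fun r a => by simp }
      map_add' := fun a b => by ext c; simp
      map_smul' := fun r a => by ext c; simp }

theorem flipForm_apply (L : V →L[ℝ] V →L[ℝ] ℝ) (v w : V) : flipForm L v w = L w v := rfl

end LinearAlgebra

section LieAlgebroid

variable {E : Type*} [NormedAddCommGroup E] [NormedSpace ℝ E]
  {M : Type*} [TopologicalSpace M] [ChartedSpace E M]

/-- A section of a vector bundle `A` (with model fibre `F`) is smooth. -/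
def IsSmoothSection (F : Type*) [NormedAddCommGroup F] [NormedSpace ℝ F]
    {A : M → Type*} [TopologicalSpace (TotalSpace F A)] [∀ x, TopologicalSpace (A x)]
    [FiberBundle F A] (s : Π x : M, A x) : Prop :=
  ContMDiff 𝓘(ℝ, E) (𝓘(ℝ, E).prod 𝓘(ℝ, F)) ∞ (fun x => TotalSpace.mk' F x (s x))

/-- A smooth real function on `M`. -/
def IsSmoothFunction (f : M → ℝ) : Prop := ContMDiff 𝓘(ℝ, E) 𝓘(ℝ, ℝ) ∞ f

variable [IsManifold 𝓘(ℝ, E) ∞ M]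
  (F : Type*) [NormedAddCommGroup F] [NormedSpace ℝ F]
  {A : M → Type*} [TopologicalSpace (TotalSpace F A)]
  [∀ x, AddCommGroup (A x)] [∀ x, Module ℝ (A x)] [∀ x, TopologicalSpace (A x)]
  [FiberBundle F A] [VectorBundle ℝ F A] [ContMDiffVectorBundle ∞ F A 𝓘(ℝ, E)]
  (ρ : Π x : M, A x →L[ℝ] TangentSpace 𝓘(ℝ, E) x)

/-- `(A, ρ, br)` is a Lie algebroid: `ρ : A → TM` is a smooth vector bundle map over the identity,
and `br` is a Lie bracket on the smooth sections of `A` satisfying the Leibniz rule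
`[a, f b] = f [a, b] + ρ(a)(f) b`. -/
structure IsLieAlgebroid (br : (Π x : M, A x) → (Π x : M, A x) → (Π x : M, A x)) : Prop where
  anchor_smooth : IsSmoothSection (E := E) (F →L[ℝ] E) (A := fun x => A x →L[ℝ] TangentSpace 𝓘(ℝ, E) x) ρ
  bracket_smooth : ∀ a b, IsSmoothSection (E := E) F a → IsSmoothSection (E := E) F b →
    IsSmoothSection (E := E) F (br a b)
  add_left : ∀ a b c, IsSmoothSection (E := E) F a → IsSmoothSection (E := E) F b →
    IsSmoothSection (E := E) F c → br (a + b) c = br a c + br b c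
  smul_left : ∀ (r : ℝ) a b, IsSmoothSection (E := E) F a → IsSmoothSection (E := E) F b →
    br (r • a) b = r • br a b
  skew : ∀ a b, IsSmoothSection (E := E) F a → IsSmoothSection (E := E) F b →
    br a b = - br b a
  jacobi : ∀ a b c, IsSmoothSection (E := E) F a → IsSmoothSection (E := E) F b →
    IsSmoothSection (E := E) F c → br a (br b c) + br b (br c a) + br c (br a b) = 0
  leibniz : ∀ (f : M → ℝ) a b, IsSmoothFunction (E := E) f → IsSmoothSection (E := E) F a →
    IsSmoothSection (E := E) F b →
    br a (fun x => f x • b x) =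
      fun x => f x • br a b x + (mvfderiv 𝓘(ℝ, E) f x (ρ x (a x))) • b x

/-- `D` is a connection on the vector bundle `A` for a Lie algebroid structure on `A`
with anchor `ρ`. -/
structure IsLieAlgebroidConnection
    (D : (Π x : M, A x) → (Π x : M, A x) → (Π x : M, A x)) : Prop where
  smooth : ∀ a b, IsSmoothSection (E := E) F a → IsSmoothSection (E := E) F b →
    IsSmoothSection (E := E) F (D a b)
  add_left : ∀ a b c, IsSmoothSection (E := E) F a → IsSmoothSection (E := E) F b →
    IsSmoothSection (E := E) F c → D (a + b) c = D a c + D b c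
  add_right : ∀ a b c, IsSmoothSection (E := E) F a → IsSmoothSection (E := E) F b →
    IsSmoothSection (E := E) F c → D a (b + c) = D a b + D a c
  smul_left : ∀ (f : M → ℝ) a b, IsSmoothFunction (E := E) f → IsSmoothSection (E := E) F a →
    IsSmoothSection (E := E) F b → D (fun x => f x • a x) b = fun x => f x • D a b x
  leibniz : ∀ (f : M → ℝ) a b, IsSmoothFunction (E := E) f → IsSmoothSection (E := E) F a →
    IsSmoothSection (E := E) F b →
    D a (fun x => f x • b x) =
      fun x => f x • D a b x + (mvfderiv 𝓘(ℝ, E) f x (ρ x (a x))) • b x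

end LieAlgebroid

section PseudoHessian

variable {E : Type*} [NormedAddCommGroup E] [NormedSpace ℝ E] [FiniteDimensional ℝ E]
  {M : Type*} [TopologicalSpace M] [ChartedSpace E M] [IsManifold 𝓘(ℝ, E) ∞ M]

/-- The cotangent space of `M` at `x`. -/
abbrev CotangentSpace (E : Type*) [NormedAddCommGroup E] [NormedSpace ℝ E]
    {M : Type*} [TopologicalSpace M] [ChartedSpace E M] (x : M) : Type _ :=
  TangentSpace 𝓘(ℝ, E) x →L[ℝ] ℝ

/-- A smooth vector field on `M`. -/
def IsSmoothVectorField (X : Π x : M, TangentSpace 𝓘(ℝ, E) x) : Prop :=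
  IsSmoothSection (E := E) E X

/-- A smooth differential one-form on `M`. -/
def IsSmoothOneForm (α : Π x : M, CotangentSpace E x) : Prop :=
  IsSmoothSection (E := E) (E →L[ℝ] ℝ) (A := fun x : M => CotangentSpace E x) α

/-- `(M, ∇)` is an affine manifold: `∇` is a smooth connection on `TM`, without torsion
and with vanishing curvature. -/
structure IsAffineManifold
    (nabla : CovariantDerivative 𝓘(ℝ, E) E (TangentSpace 𝓘(ℝ, E) : M → Type _)) : Prop where
  smooth : CovariantDerivative.ContMDiffCovariantDerivative nabla ∞
  torsion_free : haveI : CompleteSpace E := FiniteDimensional.complete ℝ E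
    nabla.torsion = 0
  curvature_zero : ∀ X Y Z : Π x : M, TangentSpace 𝓘(ℝ, E) x,
    IsSmoothVectorField X → IsSmoothVectorField Y → IsSmoothVectorField Z → ∀ x : M,
    nabla (fun y => nabla Z y (Y y)) x (X x) - nabla (fun y => nabla Z y (X y)) x (Y x)
      - nabla Z x (VectorField.mlieBracket 𝓘(ℝ, E) X Y x) = 0

variable (E M) in
/-- A smooth symmetric bivector field on `M`, seen as a symmetric bilinear form on each
cotangent space. -/
structure SymmetricBivectorField where
  toFun : Π x : M, CotangentSpace E x →L[ℝ] CotangentSpace E x →L[ℝ] ℝ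
  symm : ∀ (x : M) (a b : CotangentSpace E x), toFun x a b = toFun x b a
  smooth : IsSmoothSection (E := E) ((E →L[ℝ] ℝ) →L[ℝ] (E →L[ℝ] ℝ) →L[ℝ] ℝ)
    (A := fun x : M => CotangentSpace E x →L[ℝ] CotangentSpace E x →L[ℝ] ℝ) toFun

/-- The contraction `h_# : T*M → TM`, characterized by `β (h_# α) = h (α, β)`. -/
def SymmetricBivectorField.sharp (h : SymmetricBivectorField E M) (x : M) :
    CotangentSpace E x →L[ℝ] TangentSpace 𝓘(ℝ, E) x :=
  haveI : FiniteDimensional ℝ (TangentSpace 𝓘(ℝ, E) x) := inferInstanceAs (FiniteDimensional ℝ E)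
  haveI : T2Space (TangentSpace 𝓘(ℝ, E) x) := inferInstanceAs (T2Space E)
  sharpMap (h.toFun x)

theorem SymmetricBivectorField.sharp_spec (h : SymmetricBivectorField E M) (x : M)
    (a b : CotangentSpace E x) : b (h.sharp x a) = h.toFun x a b :=
  haveI : FiniteDimensional ℝ (TangentSpace 𝓘(ℝ, E) x) := inferInstanceAs (FiniteDimensional ℝ E)
  haveI : T2Space (TangentSpace 𝓘(ℝ, E) x) := inferInstanceAs (T2Space E)
  sharpMap_spec (h.toFun x) a b

variable (nabla : CovariantDerivative 𝓘(ℝ, E) E (TangentSpace 𝓘(ℝ, E) : M → Type _))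

set_option linter.unusedSectionVars false

/-- Auxiliary to `dualConnection`: `Y ↦ (v ↦ v(β(Y)) - β(∇_v Y))` at the point `x`. -/
def dualConnectionAux (β : Π x : M, CotangentSpace E x) (x : M)
    (Y : Π x : M, TangentSpace 𝓘(ℝ, E) x) : TangentSpace 𝓘(ℝ, E) x →L[ℝ] ℝ :=
  mvfderiv 𝓘(ℝ, E) (fun y => β y (Y y)) x - (β x).comp (nabla Y x)

theorem mdifferentiableAt_apply {β : Π x : M, CotangentSpace E x} {x : M}
    (hβ : MDifferentiableAt 𝓘(ℝ, E) (𝓘(ℝ, E).prod 𝓘(ℝ, E →L[ℝ] ℝ))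
      (fun y => TotalSpace.mk' (E →L[ℝ] ℝ) (E := fun y : M => CotangentSpace E y) y (β y)) x)
    {Y : Π x : M, TangentSpace 𝓘(ℝ, E) x}
    (hY : MDifferentiableAt 𝓘(ℝ, E) (𝓘(ℝ, E).prod 𝓘(ℝ, E))
      (fun y => TotalSpace.mk' E y (Y y)) x) :
    MDifferentiableAt 𝓘(ℝ, E) 𝓘(ℝ, ℝ) (fun y => β y (Y y)) x := by
  have h := MDifferentiableAt.clm_bundle_apply (F₁ := E) (F₂ := ℝ)
    (E₂ := Bundle.Trivial M ℝ) hβ hY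
  rw [mdifferentiableAt_totalSpace] at h
  exact h.2

theorem dualConnectionAux_tensorial {β : Π x : M, CotangentSpace E x} {x : M}
    (hβ : MDifferentiableAt 𝓘(ℝ, E) (𝓘(ℝ, E).prod 𝓘(ℝ, E →L[ℝ] ℝ))
      (fun y => TotalSpace.mk' (E →L[ℝ] ℝ) (E := fun y : M => CotangentSpace E y) y (β y)) x) :
    TensorialAt 𝓘(ℝ, E) E (dualConnectionAux nabla β x) x where
  smul {f Y} hf hY := by
    ext v
    simp [dualConnectionAux, mvfderiv_fun_mul hf (mdifferentiableAt_apply hβ hY),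
      nabla.isCovariantDerivativeOn.leibniz hY hf]
    ring
  add {Y Z} hY hZ := by
    ext v
    simp [dualConnectionAux, mvfderiv_fun_add (mdifferentiableAt_apply hβ hY)
      (mdifferentiableAt_apply hβ hZ), nabla.isCovariantDerivativeOn.add hY hZ]
    abel

open Classical in
/-- The connection induced by `∇` on one-forms: `dualConnection nabla β x v` is `∇_v β`, the
covector at `x` such that `(∇_v β)(Y) = v(β(Y)) - β(∇_v Y)` for all vector fields `Y`
(see `dualConnection_apply`). It is set to zero where `β` is not differentiable. -/
def dualConnection (β : Π x : M, CotangentSpace E x) (x : M) :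
    TangentSpace 𝓘(ℝ, E) x →L[ℝ] CotangentSpace E x :=
  if hβ : MDifferentiableAt 𝓘(ℝ, E) (𝓘(ℝ, E).prod 𝓘(ℝ, E →L[ℝ] ℝ))
      (fun y => TotalSpace.mk' (E →L[ℝ] ℝ) (E := fun y : M => CotangentSpace E y) y (β y)) x
  then
    haveI : FiniteDimensional ℝ (TangentSpace 𝓘(ℝ, E) x) :=
      inferInstanceAs (FiniteDimensional ℝ E)
    haveI : T2Space (TangentSpace 𝓘(ℝ, E) x) := inferInstanceAs (T2Space E)
    flipForm
      (TensorialAt.mkHom (dualConnectionAux nabla β x) x (dualConnectionAux_tensorial nabla hβ))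
  else 0

theorem dualConnection_apply {β : Π x : M, CotangentSpace E x} {x : M}
    (hβ : MDifferentiableAt 𝓘(ℝ, E) (𝓘(ℝ, E).prod 𝓘(ℝ, E →L[ℝ] ℝ))
      (fun y => TotalSpace.mk' (E →L[ℝ] ℝ) (E := fun y : M => CotangentSpace E y) y (β y)) x)
    {Y : Π x : M, TangentSpace 𝓘(ℝ, E) x}
    (hY : MDifferentiableAt 𝓘(ℝ, E) (𝓘(ℝ, E).prod 𝓘(ℝ, E))
      (fun y => TotalSpace.mk' E y (Y y)) x) (v : TangentSpace 𝓘(ℝ, E) x) :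
    dualConnection nabla β x v (Y x) =
      mvfderiv 𝓘(ℝ, E) (fun y => β y (Y y)) x v - β x (nabla Y x v) := by
  have h := TensorialAt.mkHom_apply (dualConnectionAux_tensorial nabla hβ) hY
  have h2 := congrArg (fun L : TangentSpace 𝓘(ℝ, E) x →L[ℝ] ℝ => L v) h
  rw [dualConnection, dif_pos hβ]
  exact h2

/-- The covariant derivative of `h`: `nablaBivector nabla h α β x v` is `(∇_v h)(α, β)`, that is
`v(h(α, β)) - h(∇_v α, β) - h(α, ∇_v β)`, at the point `x`. -/
def nablaBivector (h : SymmetricBivectorField E M) (α β : Π x : M, CotangentSpace E x) (x : M) :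
    TangentSpace 𝓘(ℝ, E) x →L[ℝ] ℝ :=
  mvfderiv 𝓘(ℝ, E) (fun y => h.toFun y (α y) (β y)) x
    - (h.toFun x (β x)).comp (dualConnection nabla α x)
    - (h.toFun x (α x)).comp (dualConnection nabla β x)

theorem nablaBivector_apply (h : SymmetricBivectorField E M)
    (α β : Π x : M, CotangentSpace E x) (x : M) (v : TangentSpace 𝓘(ℝ, E) x) :
    nablaBivector nabla h α β x v =
      mvfderiv 𝓘(ℝ, E) (fun y => h.toFun y (α y) (β y)) x v
        - h.toFun x (dualConnection nabla α x v) (β x)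
        - h.toFun x (α x) (dualConnection nabla β x v) := by
  rw [h.symm x _ (β x)]
  rfl

/-- `h` is a pseudo-Hessian bivector field: the contravariant Codazzi equation
`(∇_{h_# α} h)(β, γ) = (∇_{h_# β} h)(α, γ)` holds for all smooth one-forms. -/
def IsPseudoHessian (h : SymmetricBivectorField E M) : Prop :=
  ∀ α β γ : Π x : M, CotangentSpace E x,
    IsSmoothOneForm α → IsSmoothOneForm β → IsSmoothOneForm γ → ∀ x : M,
    nablaBivector nabla h β γ x (h.sharp x (α x)) = nablaBivector nabla h α γ x (h.sharp x (β x))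

/-- The bracket `[α, β]_h = ∇_{h_# α} β - ∇_{h_# β} α` on one-forms. -/
def formBracket (h : SymmetricBivectorField E M) (α β : Π x : M, CotangentSpace E x) :
    Π x : M, CotangentSpace E x :=
  fun x => dualConnection nabla β x (h.sharp x (α x)) - dualConnection nabla α x (h.sharp x (β x))

/-- The operator `D` on one-forms: `(D_α β)(X) = (∇_X h)(α, β) + (∇_{h_# α} β)(X)`. -/
def formConnection (h : SymmetricBivectorField E M) (α β : Π x : M, CotangentSpace E x) :
    Π x : M, CotangentSpace E x :=
  fun x => nablaBivector nabla h α β x + dualConnection nabla β x (h.sharp x (α x))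

end PseudoHessian

end

/-! Write `A`, `B`, `C` for the images of one-forms α, β, γ under `h_#`. Since ∇ has no torsion,
pairing γ with `[A, B]` gives γ of `h_# [α, β]_h` plus the defect `(∇_A h)(β, γ) - (∇_B h)(α, γ)`.
The Codazzi equation is therefore exactly the statement that `h_#` intertwines the brackets
(`isPseudoHessian_iff_sharp_formBracket`).

If it holds, the Jacobi identity follows from flatness of the dual connection, which turns each
`∇_{[A, B]}` into a commutator. Conversely, in any Lie algebroid the Jacobi identity for `a, b, f
c`, expanded by Leibniz, forces the anchor to preserve brackets (`mvfderiv_anchor_bracket_smul`).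

For `D`, the key is the operator `S_α X = [A, X] + h_# (∇_X α)` on vector fields, for which `(D_α
γ)(X) = A(γ(X)) - γ(S_α X)`. Flatness of `D` then reduces to `S_{[α, β]_h} = [S_α, S_β]`
(`dualFormConnection_formBracket`), a consequence of Jacobi for vector fields, flatness of ∇ and the
bracket morphism property. -/

/-! ### Smooth sections and how to test smoothness against global sections -/

section SmoothSections

variable {E : Type*} [NormedAddCommGroup E] [NormedSpace ℝ E]
  {M : Type*} [TopologicalSpace M] [ChartedSpace E M]
  {F : Type*} [NormedAddCommGroup F] [NormedSpace ℝ F]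
  {V : M → Type*} [TopologicalSpace (TotalSpace F V)]
  [∀ x, TopologicalSpace (V x)] [FiberBundle F V]

theorem IsSmoothSection.mdifferentiableAt {s : Π x : M, V x}
    (hs : IsSmoothSection (E := E) F s) (x : M) :
    MDifferentiableAt 𝓘(ℝ, E) (𝓘(ℝ, E).prod 𝓘(ℝ, F)) (fun x => TotalSpace.mk' F x (s x)) x :=
  (hs x).mdifferentiableAt (by simp)

variable [∀ x, AddCommGroup (V x)] [∀ x, Module ℝ (V x)] [VectorBundle ℝ F V]
  {F' : Type*} [NormedAddCommGroup F'] [NormedSpace ℝ F']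
  {W : M → Type*} [TopologicalSpace (TotalSpace F' W)]
  [∀ x, AddCommGroup (W x)] [∀ x, Module ℝ (W x)] [∀ x, TopologicalSpace (W x)]
  [FiberBundle F' W] [VectorBundle ℝ F' W]

theorem IsSmoothFunction.mdifferentiableAt {f : M → ℝ}
    (hf : IsSmoothFunction (E := E) f) (x : M) :
    MDifferentiableAt 𝓘(ℝ, E) 𝓘(ℝ, ℝ) f x :=
  (hf x).mdifferentiableAt (by simp)

theorem IsSmoothSection.add {s t : Π x : M, V x}
    (hs : IsSmoothSection (E := E) F s) (ht : IsSmoothSection (E := E) F t) :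
    IsSmoothSection (E := E) F (s + t) := ContMDiff.add_section hs ht

theorem IsSmoothSection.sub {s t : Π x : M, V x}
    (hs : IsSmoothSection (E := E) F s) (ht : IsSmoothSection (E := E) F t) :
    IsSmoothSection (E := E) F (s - t) := ContMDiff.sub_section hs ht

theorem IsSmoothSection.smul {f : M → ℝ} {s : Π x : M, V x}
    (hf : IsSmoothFunction (E := E) f) (hs : IsSmoothSection (E := E) F s) :
    IsSmoothSection (E := E) F (fun x => f x • s x) := ContMDiff.smul_section hf hs

theorem IsSmoothFunction.sub {f g : M → ℝ}
    (hf : IsSmoothFunction (E := E) f) (hg : IsSmoothFunction (E := E) g) :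
    IsSmoothFunction (E := E) (fun x => f x - g x) := ContMDiff.sub hf hg

theorem IsSmoothSection.apply [∀ x, IsTopologicalAddGroup (W x)] [∀ x, ContinuousSMul ℝ (W x)]
    {φ : Π x : M, V x →L[ℝ] W x} {s : Π x : M, V x}
    (hφ : IsSmoothSection (E := E) (F →L[ℝ] F') (A := fun x => V x →L[ℝ] W x) φ)
    (hs : IsSmoothSection (E := E) F s) :
    IsSmoothSection (E := E) F' (fun x => φ x (s x)) :=
  ContMDiff.clm_bundle_apply hφ hs

/-- Allows the dual bundle to be handled as the Hom bundle into the trivial line bundle. -/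
theorem isSmoothFunction_iff_isSmoothSection {f : M → ℝ} :
    IsSmoothFunction (E := E) f ↔
      IsSmoothSection (E := E) ℝ (A := Bundle.Trivial M ℝ) f := by
  refine forall_congr' fun x => ?_
  rw [contMDiffAt_section]
  rfl

theorem IsSmoothSection.apply_real {φ : Π x : M, V x →L[ℝ] ℝ} {s : Π x : M, V x}
    (hφ : IsSmoothSection (E := E) (F →L[ℝ] ℝ) (A := fun x => V x →L[ℝ] ℝ) φ)
    (hs : IsSmoothSection (E := E) F s) :
    IsSmoothFunction (E := E) (fun x => φ x (s x)) :=
  isSmoothFunction_iff_isSmoothSection.2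
    (IsSmoothSection.apply (W := Bundle.Trivial M ℝ) (F' := ℝ) hφ hs)

theorem contMDiffAt_clm_of_apply [FiniteDimensional ℝ F] {L : M → F →L[ℝ] F'} {x : M}
    (h : ∀ v, ContMDiffAt 𝓘(ℝ, E) 𝓘(ℝ, F') ∞ (fun y => L y v) x) :
    ContMDiffAt 𝓘(ℝ, E) 𝓘(ℝ, F →L[ℝ] F') ∞ L x := by
  let b := Module.finBasis ℝ F
  have hL : L = fun y => ∑ i, ContinuousLinearMap.smulRightL ℝ F F'
      (LinearMap.toContinuousLinearMap (b.coord i)) (L y (b i)) := by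
    funext y
    ext v
    conv_lhs => rw [← b.sum_repr v]
    simp only [map_sum, map_smul]
    simp
  rw [hL]
  refine contMDiffAt_finsetSum fun i _ => ?_
  exact ContMDiffAt.clm_apply contMDiffAt_const (h (b i))

variable [FiniteDimensional ℝ E] [T2Space M] [IsManifold 𝓘(ℝ, E) ∞ M]
  [ContMDiffVectorBundle ∞ F V 𝓘(ℝ, E)]

/-- A germ of section which is constant in a trivialization extends to a global smooth section. -/
theorem exists_isSmoothSection_trivializationAt_eq (x : M) (w : F) :
    ∃ s : Π x : M, V x, IsSmoothSection (E := E) F s ∧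
      ∀ᶠ y in nhds x, (trivializationAt F V x ⟨y, s y⟩).2 = w := by
  set t := trivializationAt F V x with ht
  have hx : x ∈ t.baseSet := FiberBundle.mem_baseSet_trivializationAt' x
  -- The support of the bump function lies inside the base set, so the product is smooth there and
  -- vanishes near every other point.
  obtain ⟨f, -, hf⟩ := (SmoothBumpFunction.nhds_basis_tsupport (I := 𝓘(ℝ, E)) x).mem_iff.1
    (t.open_baseSet.mem_nhds hx)
  refine ⟨fun y => f y • t.symm y w, fun y => ?_, ?_⟩
  · by_cases hy : y ∈ tsupport f
    · have hyt : y ∈ t.baseSet := hf hy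
      refine ContMDiffAt.smul_section (V := V) (s := fun y => t.symm y w) f.contMDiffAt ?_
      have : ContMDiffOn 𝓘(ℝ, E) (𝓘(ℝ, E).prod 𝓘(ℝ, F)) ∞
          (fun y => TotalSpace.mk' F y (t.symm y w)) t.baseSet := by
        intro z hz
        rw [t.contMDiffWithinAt_section _ hz]
        refine (contMDiffWithinAt_const (c := w)).congr (fun y hy => ?_) ?_
        · simp [hy]
        · simp [hz]
      exact this.contMDiffAt (t.open_baseSet.mem_nhds hyt)
    · have h0 : (fun z => TotalSpace.mk' F z (f z • t.symm z w)) =ᶠ[nhds y]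
          fun z => TotalSpace.mk' F z (0 : V z) := by
        filter_upwards [(isClosed_tsupport f).isOpen_compl.mem_nhds hy] with z hz
        rw [image_eq_zero_of_notMem_tsupport hz, zero_smul]
      exact (Bundle.contMDiff_zeroSection ℝ V y).congr_of_eventuallyEq h0
  · filter_upwards [f.eventuallyEq_one, t.open_baseSet.mem_nhds hx] with y hy hyt
    simp [hy, hyt]

theorem exists_isSmoothSection_apply_eq (x : M) (v : V x) :
    ∃ s : Π x : M, V x, IsSmoothSection (E := E) F s ∧ s x = v := by
  obtain ⟨s, hs, h⟩ := exists_isSmoothSection_trivializationAt_eq (E := E) (F := F) (V := V) x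
    (trivializationAt F V x ⟨x, v⟩).2
  refine ⟨s, hs, ?_⟩
  have hx : x ∈ (trivializationAt F V x).baseSet := FiberBundle.mem_baseSet_trivializationAt' x
  have h' := h.self_of_nhds
  exact ((trivializationAt F V x).continuousLinearEquivAt ℝ x hx).injective h'

/-- A section of a `Hom` bundle is smooth as soon as it maps smooth sections to smooth sections. -/
theorem isSmoothSection_clm_of_apply [FiniteDimensional ℝ F]
    [∀ x, IsTopologicalAddGroup (W x)] [∀ x, ContinuousSMul ℝ (W x)]
    {φ : Π x : M, V x →L[ℝ] W x}
    (h : ∀ s : Π x : M, V x, IsSmoothSection (E := E) F s →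
      IsSmoothSection (E := E) F' (fun x => φ x (s x))) :
    IsSmoothSection (E := E) (F →L[ℝ] F') (A := fun x => V x →L[ℝ] W x) φ := by
  intro x
  refine (contMDiffAt_hom_bundle _).2 ⟨contMDiffAt_id, contMDiffAt_clm_of_apply fun v => ?_⟩
  -- Near `x` the section `s` has constant coordinate `v`, so the coordinates of `φ s` are those of
  -- `φ` applied to the fixed vector `v`.
  obtain ⟨s, hs, hsv⟩ :=
    exists_isSmoothSection_trivializationAt_eq (E := E) (F := F) (V := V) x v
  have h1 := (contMDiffAt_section x).1 (h s hs x)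
  refine h1.congr_of_eventuallyEq ?_
  filter_upwards [hsv, (trivializationAt F V x).open_baseSet.mem_nhds
    (FiberBundle.mem_baseSet_trivializationAt' x),
    (trivializationAt F' W x).open_baseSet.mem_nhds
    (FiberBundle.mem_baseSet_trivializationAt' x)] with y hy hyV hyW
  rw [ContinuousLinearMap.inCoordinates_eq hyV hyW, ← hy]
  simp [hyV]

theorem isSmoothSection_dual_of_apply [FiniteDimensional ℝ F] {φ : Π x : M, V x →L[ℝ] ℝ}
    (h : ∀ s : Π x : M, V x, IsSmoothSection (E := E) F s →
      IsSmoothFunction (E := E) (fun x => φ x (s x))) :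
    IsSmoothSection (E := E) (F →L[ℝ] ℝ) (A := fun x => V x →L[ℝ] ℝ) φ :=
  isSmoothSection_clm_of_apply (W := Bundle.Trivial M ℝ) (F' := ℝ)
    fun s hs => isSmoothFunction_iff_isSmoothSection.1 (h s hs)

/-- A section is smooth as soon as its pairings with smooth sections of the dual bundle are. -/
theorem isSmoothSection_of_dual_apply [FiniteDimensional ℝ F] {s : Π x : M, V x}
    (h : ∀ φ : Π x : M, V x →L[ℝ] ℝ,
      IsSmoothSection (E := E) (F →L[ℝ] ℝ) (A := fun x => V x →L[ℝ] ℝ) φ →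
      IsSmoothFunction (E := E) (fun x => φ x (s x))) :
    IsSmoothSection (E := E) F s := by
  intro x
  rw [contMDiffAt_section]
  let b := Module.finBasis ℝ F
  have hb : (fun y => (trivializationAt F V x ⟨y, s y⟩).2) = fun y =>
      ∑ i, b.coord i (trivializationAt F V x ⟨y, s y⟩).2 • b i := by
    funext y
    exact (b.sum_repr _).symm
  rw [hb]
  suffices hc : ∀ i, ContMDiffAt 𝓘(ℝ, E) 𝓘(ℝ, ℝ) ∞
      (fun y => b.coord i (trivializationAt F V x ⟨y, s y⟩).2) x from
    contMDiffAt_finsetSum fun i _ => (hc i).smul contMDiffAt_const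
  intro i
  -- A global covector field that is locally the `i`-th coordinate functional: pairing with it reads
  -- off the `i`-th coordinate of `s` near `x`.
  obtain ⟨φ, hφ, hφv⟩ := exists_isSmoothSection_trivializationAt_eq (E := E)
    (F := F →L[ℝ] ℝ) (V := fun x => V x →L[ℝ] Bundle.Trivial M ℝ x) x
    (LinearMap.toContinuousLinearMap (b.coord i))
  refine (h φ hφ x).congr_of_eventuallyEq ?_
  filter_upwards [hφv, (trivializationAt F V x).open_baseSet.mem_nhds
    (FiberBundle.mem_baseSet_trivializationAt' x)] with y hy hyV
  have hi : b.coord i (trivializationAt F V x ⟨y, s y⟩).2 =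
    LinearMap.toContinuousLinearMap (b.coord i) (trivializationAt F V x ⟨y, s y⟩).2 := rfl
  rw [hi, ← hy, hom_trivializationAt_apply,
    ContinuousLinearMap.inCoordinates_eq hyV (by simp)]
  simp [hyV]

end SmoothSections

/-! ### Derivatives of smooth functions -/

section Functions

variable {E : Type*} [NormedAddCommGroup E] [NormedSpace ℝ E]
  {M : Type*} [TopologicalSpace M] [ChartedSpace E M] [IsManifold 𝓘(ℝ, E) ∞ M]

theorem IsSmoothFunction.mvfderiv_apply {f : M → ℝ} (hf : IsSmoothFunction (E := E) f)
    {X : Π x : M, TangentSpace 𝓘(ℝ, E) x} (hX : IsSmoothVectorField X) :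
    IsSmoothFunction (E := E) (fun x => mvfderiv 𝓘(ℝ, E) f x (X x)) := by
  have h1 := ContMDiff.contMDiff_tangentMap (m := ∞) hf (by simp)
  exact (contMDiff_snd_tangentBundle_modelSpace ℝ 𝓘(ℝ, ℝ)).comp (h1.comp hX)

/-- Take a linear functional of the chart, cut off by a bump function equal to one near `x`;
composing `a` with the inverse of the derivative of the chart gives the right functional. -/
theorem exists_isSmoothFunction_mvfderiv_eq [FiniteDimensional ℝ E] [T2Space M] (x : M)
    (a : TangentSpace 𝓘(ℝ, E) x →L[ℝ] ℝ) :
    ∃ f : M → ℝ, IsSmoothFunction (E := E) f ∧ mvfderiv 𝓘(ℝ, E) f x = a := by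
  have hinv : (mfderiv 𝓘(ℝ, E) 𝓘(ℝ, E) (extChartAt 𝓘(ℝ, E) x) x).IsInvertible :=
    isInvertible_mfderiv_extChartAt (mem_extChartAt_source x)
  obtain ⟨e, he⟩ := hinv
  let L : E →L[ℝ] ℝ := a.comp e.symm.toContinuousLinearMap
  let g : SmoothBumpFunction 𝓘(ℝ, E) x := Classical.arbitrary _
  refine ⟨fun y => g y • L (extChartAt 𝓘(ℝ, E) x y), ?_, ?_⟩
  · refine g.contMDiff_smul ?_
    exact L.contMDiff.comp_contMDiffOn contMDiffOn_extChartAt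
  · have h1 : (fun y => g y • L (extChartAt 𝓘(ℝ, E) x y)) =ᶠ[nhds x]
        L ∘ extChartAt 𝓘(ℝ, E) x := by
      filter_upwards [g.eventuallyEq_one] with y hy
      simp [hy]
    have h2 : mvfderiv 𝓘(ℝ, E) (fun y => g y • L (extChartAt 𝓘(ℝ, E) x y)) x =
        mvfderiv 𝓘(ℝ, E) (L ∘ extChartAt 𝓘(ℝ, E) x) x := by
      ext v
      exact congrArg (fun T : TangentSpace 𝓘(ℝ, E) x →L[ℝ] ℝ => T v) h1.mfderiv_eq
    have hL : mvfderiv 𝓘(ℝ, E) L (extChartAt 𝓘(ℝ, E) x x) = L := by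
      ext v
      exact congrArg (fun T : E →L[ℝ] ℝ => T v)
        ((mfderiv_eq_fderiv (f := L)).trans L.fderiv)
    rw [h2, mvfderiv_comp x (L.differentiableAt.mdifferentiableAt)
      (mdifferentiableAt_extChartAt (mem_chart_source E x)), hL]
    ext v
    rw [← he]
    exact congrArg a (e.symm_apply_apply v)

end Functions

/-! ### The anchor of a Lie algebroid preserves brackets; the case of the tangent bundle -/

section AnchorBracket

variable {E : Type*} [NormedAddCommGroup E] [NormedSpace ℝ E]
  {M : Type*} [TopologicalSpace M] [ChartedSpace E M] [IsManifold 𝓘(ℝ, E) ∞ M]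
  {F : Type*} [NormedAddCommGroup F] [NormedSpace ℝ F]
  {A : M → Type*} [TopologicalSpace (TotalSpace F A)]
  [∀ x, AddCommGroup (A x)] [∀ x, Module ℝ (A x)] [∀ x, TopologicalSpace (A x)]
  [FiberBundle F A] [VectorBundle ℝ F A]
  {ρ : Π x : M, A x →L[ℝ] TangentSpace 𝓘(ℝ, E) x}
  {br : (Π x : M, A x) → (Π x : M, A x) → (Π x : M, A x)}

/-- The Jacobi identity for `a`, `b`, `f c` forces `ρ [a, b] f = ρ a (ρ b f) - ρ b (ρ a f)`,
at least after multiplication by any section `c`. -/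
theorem IsLieAlgebroid.mvfderiv_anchor_bracket_smul (hA : IsLieAlgebroid F ρ br)
    {f : M → ℝ} (hf : IsSmoothFunction (E := E) f) {a b c : Π x : M, A x}
    (ha : IsSmoothSection (E := E) F a) (hb : IsSmoothSection (E := E) F b)
    (hc : IsSmoothSection (E := E) F c) (x : M) :
    mvfderiv 𝓘(ℝ, E) f x (ρ x (br a b x)) • c x =
      (mvfderiv 𝓘(ℝ, E) (fun y => mvfderiv 𝓘(ℝ, E) f y (ρ y (b y))) x (ρ x (a x)) -
        mvfderiv 𝓘(ℝ, E) (fun y => mvfderiv 𝓘(ℝ, E) f y (ρ y (a y))) x (ρ x (b x))) • c x := by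
  have hρ : ∀ {s : Π x : M, A x}, IsSmoothSection (E := E) F s →
      IsSmoothFunction (E := E) (fun y => mvfderiv 𝓘(ℝ, E) f y (ρ y (s y))) := fun hs =>
    hf.mvfderiv_apply (hA.anchor_smooth.apply hs)
  have key : ∀ {a b : Π x : M, A x}, IsSmoothSection (E := E) F a → IsSmoothSection (E := E) F b →
      br a (br b (fun y => f y • c y)) = fun x =>
        f x • br a (br b c) x + mvfderiv 𝓘(ℝ, E) f x (ρ x (a x)) • br b c x +
        (mvfderiv 𝓘(ℝ, E) f x (ρ x (b x)) • br a c x +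
        mvfderiv 𝓘(ℝ, E) (fun y => mvfderiv 𝓘(ℝ, E) f y (ρ y (b y))) x (ρ x (a x)) • c x) := by
    intro a b ha hb
    have hbc := hA.bracket_smooth b c hb hc
    have add_right : ∀ {s t : Π x : M, A x}, IsSmoothSection (E := E) F s →
        IsSmoothSection (E := E) F t → br a (s + t) = br a s + br a t := by
      intro s t hs ht
      rw [hA.skew _ _ ha (hs.add ht), hA.add_left _ _ _ hs ht ha, hA.skew _ _ ha hs,
        hA.skew _ _ ha ht]
      abel
    rw [hA.leibniz f b c hf hb hc]
    have h := add_right (IsSmoothSection.smul hf hbc) (IsSmoothSection.smul (hρ hb) hc)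
    rw [hA.leibniz f a _ hf ha hbc, hA.leibniz _ a c (hρ hb) ha hc] at h
    exact h
  have hfc := IsSmoothSection.smul hf hc
  have hac := hA.bracket_smooth a c ha hc
  have hab := hA.bracket_smooth a b ha hb
  -- Brings the Jacobi sum to the form where `c` or `f c` is always innermost on the right, so that
  -- only the right Leibniz rule is needed.
  have hneg : ∀ {s t u : Π x : M, A x}, IsSmoothSection (E := E) F s →
      IsSmoothSection (E := E) F t → IsSmoothSection (E := E) F u →
      br s (br t u) = - br s (br u t) := by
    intro s t u hs ht hu
    rw [hA.skew _ _ hs (hA.bracket_smooth _ _ ht hu), hA.skew t u ht hu]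
    have h := hA.smul_left (-1) (br u t) s (hA.bracket_smooth _ _ hu ht) hs
    rw [neg_one_smul, neg_one_smul] at h
    rw [h, hA.skew _ _ hs (hA.bracket_smooth _ _ hu ht)]
  have j0 := congrFun (hA.jacobi a b c ha hb hc) x
  have j1 := congrFun (hA.jacobi a b _ ha hb hfc) x
  rw [hneg hb hc ha, hA.skew c _ hc hab] at j0
  rw [hneg hb hfc ha, hA.skew _ _ hfc hab, key ha hb, key hb ha, hA.leibniz f _ c hf hab hc] at j1
  simp only [Pi.add_apply, Pi.neg_apply, Pi.zero_apply] at j0 j1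
  -- Subtracting `f` times the Jacobi identity for `a, b, c` removes the double brackets; the
  -- first-order terms cancel in pairs and only multiples of `c` survive.
  have j2 : f x • (br a (br b c) x + -br b (br a c) x + -br (br a b) c x) = 0 := by
    rw [j0, smul_zero]
  rw [← sub_eq_zero, ← neg_eq_zero, ← j1, ← sub_eq_zero, ← neg_eq_zero, ← j2]
  module

theorem IsSmoothVectorField.mlieBracket [FiniteDimensional ℝ E] {X Y : Π x : M, TangentSpace 𝓘(ℝ, E) x}
    (hX : IsSmoothVectorField X) (hY : IsSmoothVectorField Y) :
    IsSmoothVectorField (VectorField.mlieBracket 𝓘(ℝ, E) X Y) := by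
  have : CompleteSpace E := FiniteDimensional.complete ℝ E
  have : IsManifold 𝓘(ℝ, E) (((⊤ : ℕ∞) : WithTop ℕ∞) + 1) M := by simpa
  have : IsManifold 𝓘(ℝ, E) (minSmoothness ℝ 2) M :=
    IsManifold.of_le (n := ∞) (by simpa using ENat.LEInfty.out)
  exact ContDiff.mlieBracket_vectorField (m := ⊤) (n := ⊤) hX hY (by simp)

theorem leibniz_identity_of_isSmoothVectorField [FiniteDimensional ℝ E]
    {X Y Z : Π x : M, TangentSpace 𝓘(ℝ, E) x}
    (hX : IsSmoothVectorField X) (hY : IsSmoothVectorField Y) (hZ : IsSmoothVectorField Z) :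
    VectorField.mlieBracket 𝓘(ℝ, E) X (VectorField.mlieBracket 𝓘(ℝ, E) Y Z) =
      VectorField.mlieBracket 𝓘(ℝ, E) (VectorField.mlieBracket 𝓘(ℝ, E) X Y) Z +
        VectorField.mlieBracket 𝓘(ℝ, E) Y (VectorField.mlieBracket 𝓘(ℝ, E) X Z) := by
  have : CompleteSpace E := FiniteDimensional.complete ℝ E
  have : IsManifold 𝓘(ℝ, E) (minSmoothness ℝ 3) M :=
    IsManifold.of_le (n := ∞) (by simpa using ENat.LEInfty.out)
  have hle : minSmoothness ℝ 2 ≤ (∞ : WithTop ℕ∞) := by simpa using ENat.LEInfty.out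
  exact VectorField.leibniz_identity_mlieBracket (ContMDiff.of_le hX hle)
    (ContMDiff.of_le hY hle) (ContMDiff.of_le hZ hle)

/-- The tangent bundle, with the identity anchor and the bracket of vector fields, is a
Lie algebroid. -/
theorem isLieAlgebroid_tangentBundle [FiniteDimensional ℝ E] [T2Space M] :
    IsLieAlgebroid (E := E) (M := M) E (A := fun x => TangentSpace 𝓘(ℝ, E) x)
      (fun x => ContinuousLinearMap.id ℝ (TangentSpace 𝓘(ℝ, E) x))
      (VectorField.mlieBracket 𝓘(ℝ, E)) := by
  have : CompleteSpace E := FiniteDimensional.complete ℝ E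
  constructor
  · exact isSmoothSection_clm_of_apply (W := fun x : M => TangentSpace 𝓘(ℝ, E) x)
      (F' := E) fun s hs => hs
  · intro a b ha hb
    exact IsSmoothVectorField.mlieBracket ha hb
  · intro a b c ha hb hc
    funext x
    exact VectorField.mlieBracket_add_left (ha.mdifferentiableAt x) (hb.mdifferentiableAt x)
  · intro r a b ha hb
    funext x
    exact VectorField.mlieBracket_const_smul_left (ha.mdifferentiableAt x)
  · intro a b ha hb
    exact VectorField.mlieBracket_swap
  · intro a b c ha hb hc
    have h := leibniz_identity_of_isSmoothVectorField ha hb hc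
    have h2 : VectorField.mlieBracket 𝓘(ℝ, E) b (VectorField.mlieBracket 𝓘(ℝ, E) c a) =
        - VectorField.mlieBracket 𝓘(ℝ, E) b (VectorField.mlieBracket 𝓘(ℝ, E) a c) := by
      funext x
      rw [VectorField.mlieBracket_swap (V := c), ← neg_one_smul ℝ (VectorField.mlieBracket _ a c),
        VectorField.mlieBracket_const_smul_right ((IsSmoothVectorField.mlieBracket ha hc).mdifferentiableAt x),
        neg_one_smul, Pi.neg_apply]
    rw [h, h2, VectorField.mlieBracket_swap (V := c)]
    abel
  · intro f a b hf ha hb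
    funext x
    rw [add_comm]
    exact VectorField.mlieBracket_smul_right (hf.mdifferentiableAt x) (hb.mdifferentiableAt x)

/-- This is the general anchor identity applied to the tangent bundle, whose anchor is the identity;
a section not vanishing at `x` is then cancelled. -/
theorem mvfderiv_mlieBracket [FiniteDimensional ℝ E] [T2Space M]
    {f : M → ℝ} (hf : IsSmoothFunction (E := E) f)
    {X Y : Π x : M, TangentSpace 𝓘(ℝ, E) x}
    (hX : IsSmoothVectorField X) (hY : IsSmoothVectorField Y) (x : M) :
    mvfderiv 𝓘(ℝ, E) f x (VectorField.mlieBracket 𝓘(ℝ, E) X Y x) =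
      mvfderiv 𝓘(ℝ, E) (fun y => mvfderiv 𝓘(ℝ, E) f y (Y y)) x (X x) -
        mvfderiv 𝓘(ℝ, E) (fun y => mvfderiv 𝓘(ℝ, E) f y (X y)) x (Y x) := by
  -- In dimension zero there is no nonzero vector to cancel, but all tangent vectors vanish.
  by_cases hE : Subsingleton E
  · have : Subsingleton (TangentSpace 𝓘(ℝ, E) x) := hE
    simp [Subsingleton.elim (_ : TangentSpace 𝓘(ℝ, E) x) 0]
  · rw [not_subsingleton_iff_nontrivial] at hE
    have : Nontrivial (TangentSpace 𝓘(ℝ, E) x) := hE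
    obtain ⟨v, hv⟩ := exists_ne (0 : TangentSpace 𝓘(ℝ, E) x)
    obtain ⟨Z, hZ, rfl⟩ := exists_isSmoothSection_apply_eq (E := E) (F := E) x v
    exact smul_left_injective ℝ hv
      (isLieAlgebroid_tangentBundle.mvfderiv_anchor_bracket_smul hf hX hY hZ x)

end AnchorBracket

/-! ### The induced connection on one-forms and its flatness -/

section AffineManifold

variable {E : Type*} [NormedAddCommGroup E] [NormedSpace ℝ E] [FiniteDimensional ℝ E]
  {M : Type*} [TopologicalSpace M] [ChartedSpace E M] [IsManifold 𝓘(ℝ, E) ∞ M]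
  {nabla : CovariantDerivative 𝓘(ℝ, E) E (TangentSpace 𝓘(ℝ, E) : M → Type _)}

theorem IsAffineManifold.isSmoothVectorField_nabla (hn : IsAffineManifold nabla)
    {X Y : Π x : M, TangentSpace 𝓘(ℝ, E) x}
    (hX : IsSmoothVectorField X) (hY : IsSmoothVectorField Y) :
    IsSmoothVectorField (fun x => nabla Y x (X x)) := by
  have h := hn.smooth.contMDiff.contMDiff (σ := Y) (by simpa using ContMDiff.contMDiffOn hY)
  exact IsSmoothSection.apply (contMDiffOn_univ.1 h) hX

theorem IsAffineManifold.nabla_sub_nabla (hn : IsAffineManifold nabla)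
    {X Y : Π x : M, TangentSpace 𝓘(ℝ, E) x}
    (hX : IsSmoothVectorField X) (hY : IsSmoothVectorField Y) (x : M) :
    nabla Y x (X x) - nabla X x (Y x) = VectorField.mlieBracket 𝓘(ℝ, E) X Y x := by
  have : CompleteSpace E := FiniteDimensional.complete ℝ E
  exact nabla.torsion_eq_zero_iff.1 hn.torsion_free (hX.mdifferentiableAt x)
    (hY.mdifferentiableAt x)

variable (nabla) in
theorem IsSmoothOneForm.dualConnection_apply {β : Π x : M, CotangentSpace E x}
    (hβ : IsSmoothOneForm β) {Y : Π x : M, TangentSpace 𝓘(ℝ, E) x} (hY : IsSmoothVectorField Y)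
    (x : M) (v : TangentSpace 𝓘(ℝ, E) x) :
    dualConnection nabla β x v (Y x) =
      mvfderiv 𝓘(ℝ, E) (fun y => β y (Y y)) x v - β x (nabla Y x v) :=
  _root_.dualConnection_apply nabla (hβ.mdifferentiableAt x) (hY.mdifferentiableAt x) v

variable [T2Space M]

theorem covector_ext {x : M} {a b : CotangentSpace E x}
    (h : ∀ Y : Π x : M, TangentSpace 𝓘(ℝ, E) x, IsSmoothVectorField Y → a (Y x) = b (Y x)) :
    a = b := by
  ext v
  obtain ⟨Y, hY, rfl⟩ := exists_isSmoothSection_apply_eq (E := E) (F := E) x v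
  exact h Y hY

theorem exists_isSmoothOneForm_apply_eq (x : M) (a : CotangentSpace E x) :
    ∃ γ : Π x : M, CotangentSpace E x, IsSmoothOneForm γ ∧ γ x = a :=
  exists_isSmoothSection_apply_eq (E := E) (F := E →L[ℝ] ℝ)
    (V := fun x : M => TangentSpace 𝓘(ℝ, E) x →L[ℝ] Bundle.Trivial M ℝ x) x a

theorem vector_ext {x : M} {v w : TangentSpace 𝓘(ℝ, E) x}
    (h : ∀ γ : Π x : M, CotangentSpace E x, IsSmoothOneForm γ → γ x v = γ x w) : v = w := by
  refine (SeparatingDual.eq_iff_forall_dual_eq (R := ℝ) (V := E) (x := v) (y := w)).2 fun a => ?_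
  obtain ⟨γ, hγ, rfl⟩ := exists_isSmoothOneForm_apply_eq x (a : CotangentSpace E x)
  exact h γ hγ

theorem isSmoothOneForm_of_apply {φ : Π x : M, CotangentSpace E x}
    (h : ∀ Y : Π x : M, TangentSpace 𝓘(ℝ, E) x, IsSmoothVectorField Y →
      IsSmoothFunction (E := E) (fun x => φ x (Y x))) : IsSmoothOneForm φ :=
  isSmoothSection_dual_of_apply h

theorem IsAffineManifold.isSmoothOneForm_dualConnection (hn : IsAffineManifold nabla)
    {X : Π x : M, TangentSpace 𝓘(ℝ, E) x} {β : Π x : M, CotangentSpace E x}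
    (hX : IsSmoothVectorField X) (hβ : IsSmoothOneForm β) :
    IsSmoothOneForm (fun x => dualConnection nabla β x (X x)) := by
  refine isSmoothOneForm_of_apply fun Y hY => ?_
  simp only [hβ.dualConnection_apply nabla hY]
  exact ((hβ.apply_real hY).mvfderiv_apply hX).sub
    (hβ.apply_real (hn.isSmoothVectorField_nabla hX hY))

variable (nabla) in
theorem dualConnection_add {β γ : Π x : M, CotangentSpace E x}
    (hβ : IsSmoothOneForm β) (hγ : IsSmoothOneForm γ) (x : M) :
    dualConnection nabla (β + γ) x = dualConnection nabla β x + dualConnection nabla γ x := by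
  ext1 v
  refine covector_ext fun Y hY => ?_
  have h : IsSmoothOneForm (β + γ) := IsSmoothSection.add hβ hγ
  rw [h.dualConnection_apply nabla hY, add_apply, add_apply,
    hβ.dualConnection_apply nabla hY, hγ.dualConnection_apply nabla hY]
  have h2 := mvfderiv_fun_add ((hβ.apply_real hY).mdifferentiableAt x)
    ((hγ.apply_real hY).mdifferentiableAt x)
  simp only [Pi.add_apply, add_apply, h2]
  ring

variable (nabla) in
theorem dualConnection_smul {f : M → ℝ} {β : Π x : M, CotangentSpace E x}
    (hf : IsSmoothFunction (E := E) f) (hβ : IsSmoothOneForm β) (x : M)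
    (v : TangentSpace 𝓘(ℝ, E) x) :
    dualConnection nabla (fun y => f y • β y) x v =
      f x • dualConnection nabla β x v + mvfderiv 𝓘(ℝ, E) f x v • β x := by
  refine covector_ext fun Y hY => ?_
  have h : IsSmoothOneForm (fun y => f y • β y) := IsSmoothSection.smul hf hβ
  change _ = f x * dualConnection nabla β x v (Y x) + mvfderiv 𝓘(ℝ, E) f x v * β x (Y x)
  rw [h.dualConnection_apply nabla hY, hβ.dualConnection_apply nabla hY]
  have h2 := mvfderiv_fun_mul (hf.mdifferentiableAt x) ((hβ.apply_real hY).mdifferentiableAt x)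
  simp only [smul_apply, add_apply, smul_eq_mul, h2]
  ring

variable (nabla) in
theorem dualConnection_const_smul (r : ℝ) {β : Π x : M, CotangentSpace E x}
    (hβ : IsSmoothOneForm β) (x : M) :
    dualConnection nabla (r • β) x = r • dualConnection nabla β x := by
  ext1 v
  have h := dualConnection_smul nabla (f := fun _ => r) contMDiff_const hβ x v
  rw [mvfderiv_const] at h
  simpa using! h

variable (nabla) in
theorem dualConnection_sub {β γ : Π x : M, CotangentSpace E x}
    (hβ : IsSmoothOneForm β) (hγ : IsSmoothOneForm γ) (x : M) :
    dualConnection nabla (β - γ) x = dualConnection nabla β x - dualConnection nabla γ x := by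
  have h := dualConnection_add nabla (IsSmoothSection.sub hβ hγ) hγ x
  rw [sub_add_cancel] at h
  rw [h, add_sub_cancel_right]

/-- The connection induced by a flat connection on one-forms is flat. -/
theorem IsAffineManifold.dualConnection_mlieBracket (hn : IsAffineManifold nabla)
    {X Y : Π x : M, TangentSpace 𝓘(ℝ, E) x} {γ : Π x : M, CotangentSpace E x}
    (hX : IsSmoothVectorField X) (hY : IsSmoothVectorField Y) (hγ : IsSmoothOneForm γ) (x : M) :
    dualConnection nabla γ x (VectorField.mlieBracket 𝓘(ℝ, E) X Y x) =
      dualConnection nabla (fun y => dualConnection nabla γ y (Y y)) x (X x) -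
        dualConnection nabla (fun y => dualConnection nabla γ y (X y)) x (Y x) := by
  refine covector_ext fun Z hZ => ?_
  have hXZ := hn.isSmoothVectorField_nabla hX hZ
  have hYZ := hn.isSmoothVectorField_nabla hY hZ
  have hγZ : IsSmoothFunction (E := E) (fun y => γ y (Z y)) := hγ.apply_real hZ
  have hd : ∀ {V : Π x : M, TangentSpace 𝓘(ℝ, E) x}, IsSmoothVectorField V →
      mvfderiv 𝓘(ℝ, E) (fun y => dualConnection nabla γ y (V y) (Z y)) x =
        mvfderiv 𝓘(ℝ, E) (fun y => mvfderiv 𝓘(ℝ, E) (fun z => γ z (Z z)) y (V y)) x -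
          mvfderiv 𝓘(ℝ, E) (fun y => γ y (nabla Z y (V y))) x := by
    intro V hV
    simp only [hγ.dualConnection_apply nabla hZ]
    exact mvfderiv_fun_sub ((hγZ.mvfderiv_apply hV).mdifferentiableAt x)
      ((hγ.apply_real (hn.isSmoothVectorField_nabla hV hZ)).mdifferentiableAt x)
  -- After pairing with `Z`, mixed terms such as `X(γ(∇_Y Z))` cancel by symmetry in `X` and `Y`,
  -- and what remains is γ applied to the curvature of ∇.
  have hR := congrArg (γ x) (hn.curvature_zero X Y Z hX hY hZ x)
  rw [map_sub, map_sub, map_zero] at hR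
  rw [sub_apply, hγ.dualConnection_apply nabla hZ,
    (hn.isSmoothOneForm_dualConnection hY hγ).dualConnection_apply nabla hZ,
    (hn.isSmoothOneForm_dualConnection hX hγ).dualConnection_apply nabla hZ,
    hγ.dualConnection_apply nabla hXZ, hγ.dualConnection_apply nabla hYZ,
    mvfderiv_mlieBracket hγZ hX hY, hd hX, hd hY,
    sub_apply, sub_apply]
  linarith

end AffineManifold

/-! ### Smoothness and symmetry of the contraction -/

section SymmetricBivectorField

variable {E : Type*} [NormedAddCommGroup E] [NormedSpace ℝ E]
  {M : Type*} [TopologicalSpace M] [ChartedSpace E M] [IsManifold 𝓘(ℝ, E) ∞ M]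

namespace SymmetricBivectorField

theorem isSmoothFunction_apply (h : SymmetricBivectorField E M)
    {α β : Π x : M, CotangentSpace E x} (hα : IsSmoothOneForm α) (hβ : IsSmoothOneForm β) :
    IsSmoothFunction (E := E) (fun x => h.toFun x (α x) (β x)) := by
  have h1 := IsSmoothSection.apply (E := E) (F := E →L[ℝ] ℝ) (F' := (E →L[ℝ] ℝ) →L[ℝ] ℝ)
    (V := fun x : M => TangentSpace 𝓘(ℝ, E) x →L[ℝ] Bundle.Trivial M ℝ x)
    (W := fun x : M => (TangentSpace 𝓘(ℝ, E) x →L[ℝ] Bundle.Trivial M ℝ x) →L[ℝ]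
      Bundle.Trivial M ℝ x) h.smooth hα
  exact IsSmoothSection.apply_real (E := E) (F := E →L[ℝ] ℝ)
    (V := fun x : M => TangentSpace 𝓘(ℝ, E) x →L[ℝ] Bundle.Trivial M ℝ x) h1 hβ

variable [FiniteDimensional ℝ E]

theorem apply_sharp_comm (h : SymmetricBivectorField E M) {x : M} (a b : CotangentSpace E x) :
    b (h.sharp x a) = a (h.sharp x b) := by
  rw [h.sharp_spec, h.sharp_spec, h.symm]

variable [T2Space M]

theorem isSmoothVectorField_sharp (h : SymmetricBivectorField E M)
    {α : Π x : M, CotangentSpace E x} (hα : IsSmoothOneForm α) :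
    IsSmoothVectorField (fun x => h.sharp x (α x)) := by
  refine isSmoothSection_of_dual_apply fun γ hγ => ?_
  simp only [h.sharp_spec]
  exact h.isSmoothFunction_apply hα hγ

theorem isSmoothSection_sharp (h : SymmetricBivectorField E M) :
    IsSmoothSection (E := E) ((E →L[ℝ] ℝ) →L[ℝ] E)
      (A := fun x : M => CotangentSpace E x →L[ℝ] TangentSpace 𝓘(ℝ, E) x) h.sharp :=
  isSmoothSection_clm_of_apply (E := E) (F := E →L[ℝ] ℝ) (F' := E)
    (V := fun x : M => TangentSpace 𝓘(ℝ, E) x →L[ℝ] Bundle.Trivial M ℝ x)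
    (W := fun x : M => TangentSpace 𝓘(ℝ, E) x) fun _ hs => h.isSmoothVectorField_sharp hs

end SymmetricBivectorField

end SymmetricBivectorField

/-! ### The Codazzi equation and the Lie algebroid structure -/

section PseudoHessianBivector

open VectorField

variable {E : Type*} [NormedAddCommGroup E] [NormedSpace ℝ E] [FiniteDimensional ℝ E]
  {M : Type*} [TopologicalSpace M] [ChartedSpace E M] [IsManifold 𝓘(ℝ, E) ∞ M]
  {nabla : CovariantDerivative 𝓘(ℝ, E) E (TangentSpace 𝓘(ℝ, E) : M → Type _)}
  {h : SymmetricBivectorField E M} {α β γ : Π x : M, CotangentSpace E x}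

variable (nabla h α β) in
theorem nablaBivector_comm (x : M) : nablaBivector nabla h α β x = nablaBivector nabla h β α x := by
  ext v
  have h1 : (fun y => h.toFun y (α y) (β y)) = fun y => h.toFun y (β y) (α y) :=
    funext fun y => h.symm y _ _
  rw [nablaBivector_apply, nablaBivector_apply, h1, h.symm x _ (β x), h.symm x (α x)]
  ring

variable [T2Space M]

variable (nabla h) in
/-- `∇_v (h_# β) = (∇_v h)_# β + h_# (∇_v β)`, paired with a one-form. -/
theorem apply_nabla_sharp (hβ : IsSmoothOneForm β) (hγ : IsSmoothOneForm γ) (x : M)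
    (v : TangentSpace 𝓘(ℝ, E) x) :
    γ x (nabla (fun y => h.sharp y (β y)) x v) =
      nablaBivector nabla h β γ x v + γ x (h.sharp x (dualConnection nabla β x v)) := by
  have h1 := hγ.dualConnection_apply nabla (h.isSmoothVectorField_sharp hβ) x v
  simp only [h.sharp_spec] at h1
  rw [nablaBivector_apply, h.sharp_spec]
  linarith

-- Absence of torsion writes the bracket as `∇_A B - ∇_B A`; in each term the derivative falls
-- either on `h` or on the form. The last difference is the Codazzi defect.
variable (h) in
theorem IsAffineManifold.apply_mlieBracket_sharp (hn : IsAffineManifold nabla)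
    (hα : IsSmoothOneForm α) (hβ : IsSmoothOneForm β) (hγ : IsSmoothOneForm γ) (x : M) :
    γ x (mlieBracket 𝓘(ℝ, E) (fun y => h.sharp y (α y)) (fun y => h.sharp y (β y)) x) =
      γ x (h.sharp x (formBracket nabla h α β x)) +
        (nablaBivector nabla h β γ x (h.sharp x (α x)) -
          nablaBivector nabla h α γ x (h.sharp x (β x))) := by
  rw [← hn.nabla_sub_nabla (h.isSmoothVectorField_sharp hα) (h.isSmoothVectorField_sharp hβ),
    map_sub, apply_nabla_sharp nabla h hβ hγ, apply_nabla_sharp nabla h hα hγ, formBracket,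
    map_sub, map_sub]
  ring

/-- The contravariant Codazzi equation says that `h_#` is a morphism of brackets. -/
theorem IsAffineManifold.isPseudoHessian_iff_sharp_formBracket (hn : IsAffineManifold nabla) :
    IsPseudoHessian nabla h ↔ ∀ α β : Π x : M, CotangentSpace E x,
      IsSmoothOneForm α → IsSmoothOneForm β → ∀ x : M, h.sharp x (formBracket nabla h α β x) =
        mlieBracket 𝓘(ℝ, E) (fun y => h.sharp y (α y)) (fun y => h.sharp y (β y)) x := by
  constructor
  · intro hP α β hα hβ x
    refine vector_ext fun γ hγ => ?_
    rw [hn.apply_mlieBracket_sharp h hα hβ hγ, hP α β γ hα hβ hγ, sub_self, add_zero]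
  · intro H α β γ hα hβ hγ x
    have h1 := hn.apply_mlieBracket_sharp h hα hβ hγ x
    rw [← H α β hα hβ] at h1
    linarith

theorem IsAffineManifold.isSmoothOneForm_formBracket (hn : IsAffineManifold nabla)
    (hα : IsSmoothOneForm α) (hβ : IsSmoothOneForm β) :
    IsSmoothOneForm (formBracket nabla h α β) :=
  IsSmoothSection.sub (hn.isSmoothOneForm_dualConnection (h.isSmoothVectorField_sharp hα) hβ)
    (hn.isSmoothOneForm_dualConnection (h.isSmoothVectorField_sharp hβ) hα)

/-- The Codazzi equation enters through `h_# [β, γ]_h = [B, C]`, leaving only second derivatives and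
one derivative along a bracket of vector fields. -/
theorem IsAffineManifold.formBracket_formBracket (hn : IsAffineManifold nabla)
    (hP : IsPseudoHessian nabla h) (hβ : IsSmoothOneForm β) (hγ : IsSmoothOneForm γ) (x : M) :
    formBracket nabla h α (formBracket nabla h β γ) x =
      dualConnection nabla (fun y => dualConnection nabla γ y (h.sharp y (β y))) x
        (h.sharp x (α x)) -
      dualConnection nabla (fun y => dualConnection nabla β y (h.sharp y (γ y))) x
        (h.sharp x (α x)) -
      dualConnection nabla α x
        (mlieBracket 𝓘(ℝ, E) (fun y => h.sharp y (β y)) (fun y => h.sharp y (γ y)) x) := by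
  rw [formBracket, hn.isPseudoHessian_iff_sharp_formBracket.1 hP β γ hβ hγ]
  have h1 := dualConnection_sub nabla
    (hn.isSmoothOneForm_dualConnection (h.isSmoothVectorField_sharp hβ) hγ)
    (hn.isSmoothOneForm_dualConnection (h.isSmoothVectorField_sharp hγ) hβ) x
  exact congrArg (fun T : TangentSpace 𝓘(ℝ, E) x →L[ℝ] CotangentSpace E x =>
    T (h.sharp x (α x)) - _) h1

theorem IsAffineManifold.isLieAlgebroid_formBracket (hn : IsAffineManifold nabla)
    (hP : IsPseudoHessian nabla h) :
    IsLieAlgebroid (E →L[ℝ] ℝ) (A := fun x : M => CotangentSpace E x)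
      h.sharp (formBracket nabla h) where
  anchor_smooth := h.isSmoothSection_sharp
  bracket_smooth _ _ ha hb := hn.isSmoothOneForm_formBracket ha hb
  add_left a b c ha hb hc := by
    funext x
    simp only [formBracket, Pi.add_apply, map_add, dualConnection_add nabla ha hb, add_apply]
    abel
  smul_left r a b ha hb := by
    funext x
    simp only [formBracket, Pi.smul_apply, map_smul, dualConnection_const_smul nabla r ha,
      smul_apply, smul_sub]
  skew a b ha hb := by
    funext x
    simp only [formBracket, Pi.neg_apply, neg_sub]
  jacobi a b c ha hb hc := by
    funext x
    have hA := h.isSmoothVectorField_sharp ha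
    have hB := h.isSmoothVectorField_sharp hb
    have hC := h.isSmoothVectorField_sharp hc
    simp only [Pi.add_apply, Pi.zero_apply]
    -- Grouped by the form being differentiated, the cyclic sum consists of three curvature
    -- expressions of the dual connection, each zero.
    rw [hn.formBracket_formBracket hP hb hc, hn.formBracket_formBracket hP hc ha,
      hn.formBracket_formBracket hP ha hb, hn.dualConnection_mlieBracket hB hC ha,
      hn.dualConnection_mlieBracket hC hA hb, hn.dualConnection_mlieBracket hA hB hc]
    abel
  leibniz f a b hf ha hb := by
    funext x
    simp only [formBracket, dualConnection_smul nabla hf hb, map_smul]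
    module

/-- It suffices that the anchor preserve brackets. The form γ plays two roles: a function with
differential `γ x` detects the difference of the two vectors, and γ itself is the section to be
cancelled when `γ x` is nonzero. -/
theorem IsAffineManifold.isPseudoHessian_of_isLieAlgebroid (hn : IsAffineManifold nabla)
    (hL : IsLieAlgebroid (E →L[ℝ] ℝ) (A := fun x : M => CotangentSpace E x)
      h.sharp (formBracket nabla h)) : IsPseudoHessian nabla h := by
  refine hn.isPseudoHessian_iff_sharp_formBracket.2 fun α β hα hβ x => vector_ext fun γ hγ => ?_
  by_cases h0 : γ x = 0
  · simp [h0]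
  obtain ⟨f, hf, hfx⟩ := exists_isSmoothFunction_mvfderiv_eq (E := E) x (γ x)
  have h1 := hL.mvfderiv_anchor_bracket_smul hf hα hβ hγ x
  rw [← mvfderiv_mlieBracket hf (h.isSmoothVectorField_sharp hα)
    (h.isSmoothVectorField_sharp hβ), hfx] at h1
  exact smul_left_injective ℝ h0 h1

/-! ### The connection `D`, its dual operator and its flatness -/

/-- The operator `[h_# α, X] + h_# (∇_X α)` on vector fields, dual to the operator `D_α`. -/
noncomputable def dualFormConnection
    (nabla : CovariantDerivative 𝓘(ℝ, E) E (TangentSpace 𝓘(ℝ, E) : M → Type _))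
    (h : SymmetricBivectorField E M) (α : Π x : M, CotangentSpace E x)
    (X : Π x : M, TangentSpace 𝓘(ℝ, E) x) : Π x : M, TangentSpace 𝓘(ℝ, E) x :=
  mlieBracket 𝓘(ℝ, E) (fun y => h.sharp y (α y)) X +
    fun x => h.sharp x (dualConnection nabla α x (X x))

theorem IsAffineManifold.isSmoothVectorField_dualFormConnection (hn : IsAffineManifold nabla)
    (hα : IsSmoothOneForm α) {X : Π x : M, TangentSpace 𝓘(ℝ, E) x} (hX : IsSmoothVectorField X) :
    IsSmoothVectorField (dualFormConnection nabla h α X) :=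
  IsSmoothSection.add ((h.isSmoothVectorField_sharp hα).mlieBracket hX)
    (h.isSmoothVectorField_sharp (hn.isSmoothOneForm_dualConnection hX hα))

/-- Expanding `(∇_X h)(α, γ)`, the terms `X(γ(A))` cancel and leave `γ(∇_X A) - γ(h_# ∇_X α)`;
absence of torsion combines `∇_X A` with the `∇_A X` coming from `(∇_A γ)(X)`. -/
theorem IsAffineManifold.formConnection_apply (hn : IsAffineManifold nabla)
    (hα : IsSmoothOneForm α) (hγ : IsSmoothOneForm γ)
    {X : Π x : M, TangentSpace 𝓘(ℝ, E) x} (hX : IsSmoothVectorField X) (x : M) :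
    formConnection nabla h α γ x (X x) =
      mvfderiv 𝓘(ℝ, E) (fun y => γ y (X y)) x (h.sharp x (α x)) -
        γ x (dualFormConnection nabla h α X x) := by
  have hA := h.isSmoothVectorField_sharp hα
  have h1 := hγ.dualConnection_apply nabla hA x (X x)
  have h2 := hγ.dualConnection_apply nabla hX x (h.sharp x (α x))
  have h3 := congrArg (γ x) (hn.nabla_sub_nabla hA hX x)
  simp only [h.sharp_spec] at h1
  rw [map_sub] at h3
  rw [formConnection, add_apply, nablaBivector_apply, dualFormConnection, Pi.add_apply, map_add,
    h.sharp_spec]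
  rw [h.sharp_spec, ← h.sharp_spec x (α x) (dualConnection nabla γ x (X x))] at *
  linarith

theorem IsAffineManifold.isSmoothOneForm_formConnection (hn : IsAffineManifold nabla)
    (hα : IsSmoothOneForm α) (hγ : IsSmoothOneForm γ) :
    IsSmoothOneForm (formConnection nabla h α γ) := by
  refine isSmoothOneForm_of_apply fun X hX => ?_
  simp only [hn.formConnection_apply hα hγ hX]
  exact ((hγ.apply_real hX).mvfderiv_apply (h.isSmoothVectorField_sharp hα)).sub
    (hγ.apply_real (hn.isSmoothVectorField_dualFormConnection hα hX))

theorem IsAffineManifold.isLieAlgebroidConnection_formConnection (hn : IsAffineManifold nabla) :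
    IsLieAlgebroidConnection (E →L[ℝ] ℝ) (A := fun x : M => CotangentSpace E x)
      h.sharp (formConnection nabla h) where
  smooth _ _ ha hb := hn.isSmoothOneForm_formConnection ha hb
  add_left a b c ha hb hc := by
    funext x
    ext v
    have h1 := mvfderiv_fun_add ((h.isSmoothFunction_apply ha hc).mdifferentiableAt x)
      ((h.isSmoothFunction_apply hb hc).mdifferentiableAt x)
    simp only [formConnection, Pi.add_apply, map_add, dualConnection_add nabla ha hb, add_apply,
      nablaBivector_apply, h1]
    ring
  add_right a b c ha hb hc := by
    funext x
    ext v
    have h1 := mvfderiv_fun_add ((h.isSmoothFunction_apply ha hb).mdifferentiableAt x)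
      ((h.isSmoothFunction_apply ha hc).mdifferentiableAt x)
    simp only [formConnection, Pi.add_apply, map_add, dualConnection_add nabla hb hc, add_apply,
      nablaBivector_apply, h1]
    ring
  smul_left f a b hf ha hb := by
    funext x
    ext v
    have h1 := mvfderiv_fun_mul (hf.mdifferentiableAt x)
      ((h.isSmoothFunction_apply ha hb).mdifferentiableAt x)
    simp only [formConnection, map_smul, dualConnection_smul nabla hf ha, add_apply, map_add,
      smul_apply, smul_eq_mul, nablaBivector_apply, h1]
    ring
  leibniz f a b hf ha hb := by
    funext x
    ext v
    have h1 := mvfderiv_fun_mul (hf.mdifferentiableAt x)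
      ((h.isSmoothFunction_apply ha hb).mdifferentiableAt x)
    simp only [formConnection, map_smul, dualConnection_smul nabla hf hb, add_apply, map_add,
      smul_apply, smul_eq_mul, nablaBivector_apply, h1]
    ring

theorem sharp_formConnection (hP : IsPseudoHessian nabla h)
    (hα : IsSmoothOneForm α) (hβ : IsSmoothOneForm β) (x : M) :
    h.sharp x (formConnection nabla h α β x) =
      nabla (fun y => h.sharp y (β y)) x (h.sharp x (α x)) := by
  refine vector_ext fun γ hγ => ?_
  -- Symmetry of `h` turns the pairing with γ into evaluation at `h_# γ`; Codazzi then exchanges γ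
  -- and α in `(∇_{h_# γ} h)(α, β)`.
  rw [apply_nabla_sharp nabla h hβ hγ, h.apply_sharp_comm, formConnection, add_apply,
    h.apply_sharp_comm (dualConnection nabla β x (h.sharp x (α x))) (γ x), hP γ α β hγ hα hβ, nablaBivector_comm]

theorem IsAffineManifold.dualFormConnection_formBracket (hn : IsAffineManifold nabla)
    (hP : IsPseudoHessian nabla h) (hα : IsSmoothOneForm α) (hβ : IsSmoothOneForm β)
    {X : Π x : M, TangentSpace 𝓘(ℝ, E) x} (hX : IsSmoothVectorField X) :
    dualFormConnection nabla h (formBracket nabla h α β) X =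
      dualFormConnection nabla h α (dualFormConnection nabla h β X) -
        dualFormConnection nabla h β (dualFormConnection nabla h α X) := by
  -- The bracket of `A` with `h_# (∇_X β)` is `h_#` of a bracket of forms; its term `∇_{h_# ∇_X β}
  -- α` cancels against the one produced by the outer operator.
  have key : ∀ {α β : Π x : M, CotangentSpace E x}, IsSmoothOneForm α → IsSmoothOneForm β →
      ∀ x, dualFormConnection nabla h α (dualFormConnection nabla h β X) x =
        mlieBracket 𝓘(ℝ, E) (fun y => h.sharp y (α y))
          (mlieBracket 𝓘(ℝ, E) (fun y => h.sharp y (β y)) X) x +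
        h.sharp x (dualConnection nabla (fun y => dualConnection nabla β y (X y)) x
          (h.sharp x (α x)) +
          dualConnection nabla α x (mlieBracket 𝓘(ℝ, E) (fun y => h.sharp y (β y)) X x)) := by
    intro α β hα hβ x
    have : CompleteSpace E := FiniteDimensional.complete ℝ E
    have hm := hn.isSmoothOneForm_dualConnection hX hβ
    have hB := h.isSmoothVectorField_sharp hβ
    rw [dualFormConnection, Pi.add_apply, dualFormConnection,
      mlieBracket_add_right ((hB.mlieBracket hX).mdifferentiableAt x)
        ((h.isSmoothVectorField_sharp hm).mdifferentiableAt x),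
      ← hn.isPseudoHessian_iff_sharp_formBracket.1 hP _ _ hα hm, formBracket, Pi.add_apply]
    simp only [map_add, map_sub]
    abel
  funext x
  have hA := h.isSmoothVectorField_sharp hα
  have hB := h.isSmoothVectorField_sharp hβ
  have h1 : (fun y => h.sharp y (formBracket nabla h α β y)) =
      mlieBracket 𝓘(ℝ, E) (fun y => h.sharp y (α y)) (fun y => h.sharp y (β y)) :=
    funext (hn.isPseudoHessian_iff_sharp_formBracket.1 hP α β hα hβ)
  have h2 : dualConnection nabla (formBracket nabla h α β) x = _ := dualConnection_sub nabla
    (hn.isSmoothOneForm_dualConnection hA hβ) (hn.isSmoothOneForm_dualConnection hB hα) x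
  have h3 := congrFun (leibniz_identity_of_isSmoothVectorField hA hB hX) x
  rw [Pi.add_apply] at h3
  -- Flatness replaces `∇_{[A, X]} β` and `∇_{[B, X]} α` by commutators, leaving `∇_X` of `∇_A β -
  -- ∇_B α`, that is of `[α, β]_h`.
  rw [Pi.sub_apply, key hα hβ, key hβ hα, dualFormConnection, Pi.add_apply, h1, h2, h3, sub_apply,
    hn.dualConnection_mlieBracket hA hX hβ, hn.dualConnection_mlieBracket hB hX hα]
  simp only [map_add, map_sub]
  abel

theorem IsAffineManifold.formConnection_curvature (hn : IsAffineManifold nabla)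
    (hP : IsPseudoHessian nabla h) (hα : IsSmoothOneForm α) (hβ : IsSmoothOneForm β)
    (hγ : IsSmoothOneForm γ) :
    formConnection nabla h (formBracket nabla h α β) γ
      - formConnection nabla h α (formConnection nabla h β γ)
      + formConnection nabla h β (formConnection nabla h α γ) = 0 := by
  funext x
  refine covector_ext fun X hX => ?_
  have hA := h.isSmoothVectorField_sharp hα
  have hB := h.isSmoothVectorField_sharp hβ
  have hγX : IsSmoothFunction (E := E) (fun y => γ y (X y)) := hγ.apply_real hX
  -- The two middle terms are exchanged when α and β are swapped, so they drop out of the commutator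
  -- of `D_α` and `D_β`.
  have key : ∀ {α β : Π x : M, CotangentSpace E x}, IsSmoothOneForm α → IsSmoothOneForm β →
      formConnection nabla h α (formConnection nabla h β γ) x (X x) =
        mvfderiv 𝓘(ℝ, E) (fun y => mvfderiv 𝓘(ℝ, E) (fun z => γ z (X z)) y (h.sharp y (β y))) x
          (h.sharp x (α x)) -
        mvfderiv 𝓘(ℝ, E) (fun y => γ y (dualFormConnection nabla h β X y)) x (h.sharp x (α x)) -
        mvfderiv 𝓘(ℝ, E) (fun y => γ y (dualFormConnection nabla h α X y)) x (h.sharp x (β x)) +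
        γ x (dualFormConnection nabla h β (dualFormConnection nabla h α X) x) := by
    intro α β hα hβ
    have hS := hn.isSmoothVectorField_dualFormConnection (h := h) hα hX
    rw [hn.formConnection_apply hα (hn.isSmoothOneForm_formConnection hβ hγ) hX,
      hn.formConnection_apply hβ hγ hS]
    simp only [hn.formConnection_apply hβ hγ hX]
    rw [mvfderiv_fun_sub
      ((hγX.mvfderiv_apply (h.isSmoothVectorField_sharp hβ)).mdifferentiableAt x)
      ((hγ.apply_real (hn.isSmoothVectorField_dualFormConnection hβ hX)).mdifferentiableAt x),
      sub_apply]
    ring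
  have h1 := hn.formConnection_apply (h := h) (hn.isSmoothOneForm_formBracket (h := h) hα hβ) hγ hX x
  rw [hn.isPseudoHessian_iff_sharp_formBracket.1 hP α β hα hβ, mvfderiv_mlieBracket hγX hA hB,
    hn.dualFormConnection_formBracket hP hα hβ hX, Pi.sub_apply, map_sub] at h1
  simp only [Pi.add_apply, Pi.sub_apply, Pi.zero_apply, add_apply, sub_apply, zero_apply]
  rw [h1, key hα hβ, key hβ hα]
  ring

end PseudoHessianBivector

theorem theorem1 {E : Type*} [NormedAddCommGroup E] [NormedSpace ℝ E] [FiniteDimensional ℝ E]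
    {M : Type*} [TopologicalSpace M] [T2Space M] [ChartedSpace E M] [IsManifold 𝓘(ℝ, E) ∞ M]
    (nabla : CovariantDerivative 𝓘(ℝ, E) E (TangentSpace 𝓘(ℝ, E) : M → Type _))
    (hnabla : IsAffineManifold nabla) (h : SymmetricBivectorField E M) :
    (IsPseudoHessian nabla h ↔
      IsLieAlgebroid (E →L[ℝ] ℝ) (A := fun x : M => CotangentSpace E x)
        h.sharp (formBracket nabla h)) ∧
    (IsPseudoHessian nabla h →
      IsLieAlgebroidConnection (E →L[ℝ] ℝ) (A := fun x : M => CotangentSpace E x)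
        h.sharp (formConnection nabla h) ∧
      ∀ α β : Π x : M, CotangentSpace E x, IsSmoothOneForm α → IsSmoothOneForm β →
        -- the anchor is a morphism of brackets
        (∀ x : M, h.sharp x (formBracket nabla h α β x) =
          VectorField.mlieBracket 𝓘(ℝ, E)
            (fun y => h.sharp y (α y)) (fun y => h.sharp y (β y)) x) ∧
        (∀ x : M, h.sharp x (formConnection nabla h α β x) =
          nabla (fun y => h.sharp y (β y)) x (h.sharp x (α x))) ∧
        (∀ γ : Π x : M, CotangentSpace E x, IsSmoothOneForm γ →
          formConnection nabla h (formBracket nabla h α β) γ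
            - formConnection nabla h α (formConnection nabla h β γ)
            + formConnection nabla h β (formConnection nabla h α γ) = 0)) := by
  exact ⟨⟨hnabla.isLieAlgebroid_formBracket, hnabla.isPseudoHessian_of_isLieAlgebroid⟩, fun hP =>
    ⟨hnabla.isLieAlgebroidConnection_formConnection, fun α β hα hβ =>
      ⟨hnabla.isPseudoHessian_iff_sharp_formBracket.1 hP α β hα hβ,
        sharp_formConnection hP hα hβ,
        fun γ hγ => hnabla.formConnection_curvature hP hα hβ hγ⟩⟩⟩
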